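/- Let $\alpha>0$, let $(\Omega,\mathcal F,P)$ be a probability space with a filtration $(\mathcal F_t)_{t\in\mathbb N}$, $\mathbb N=\{0,1,2,\dots\}$, and let $(X_t)_{t\in\mathbb N}$ be a real-valued martingale with respect to $(\mathcal F_t)_{t\in\mathbb N}$ with $0\le X_t\le 1$ almost surely for every $t$. For $\nu\in\{-1,+1\}$ define random times with values in $\mathbb N\cup\{\infty\}$ by $T'_{0,\nu}:=0$ and, for $k\ge 0$, $$T'_{2k+1,\nu}:=\inf\{t>T'_{2k,\nu} \mid \nu X_t\le \nu X_{T'_{2k,\nu}}-\alpha\},\qquad T'_{2k+2,\nu}:=\inf\{t>T'_{2k+1,\nu}\mid \nu X_t\ge \nu X_{T'_{2k+1,\nu}}+\alpha\},$$ where $\inf\emptyset=\infty$ (and the time is $\infty$ if the preceding one is). Put $T'_k:=\min\{T'_{k,-1},T'_{k,+1}\}$. The number of $\alpha$-alternations up to time $t$ is $A_t(\alpha):=\sup\{k\ge 0\mid T'_k\le t\}$, and the total number of $\alpha$-alternations is $A(\alpha):=\sup_{t\in\mathbb N}A_t(\alpha)\in\mathbb N\cup\{\infty\}$. Then $A(\alpha)$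 is a random variable and $$\mathbb E[A(\alpha)]\le \frac1\alpha .$$ -/

import Mathlib

open MeasureTheory
open scoped ENNReal

/-- `alternationTime X α ν k ω` is the time `T'_{k,ν}(ω) ∈ ℕ ∪ {∞}` at which the `k`-th step of the
`α`-alternating sequence of sign `ν ∈ {1, -1}` is completed along the path of `ω`: `T'_{0,ν} = 0`,
`T'_{2j+1,ν}` is the first time after `T'_{2j,ν}` at which `ν X` has fallen by at least `α`
from its value at time `T'_{2j,ν}`, and `T'_{2j+2,ν}` is the first time after `T'_{2j+1,ν}` at which
`ν X` has risen by at least `α` from its value at time `T'_{2j+1,ν}`. The infimum of the empty set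
is `∞ = ⊤`, and once one of these times is `⊤` so are all the later ones (no `t` is `> ⊤`), so
that `toNat` is only ever relevant at finite times. For `ν = 1` the sequence starts with a decrease,
for `ν = -1` with an increase. -/
noncomputable def alternationTime {Ω : Type*} (X : ℕ → Ω → ℝ) (α ν : ℝ) : ℕ → Ω → ℕ∞
  | 0, _ => 0
  | k + 1, ω =>
      sInf {s : ℕ∞ | ∃ t : ℕ, s = (t : ℕ∞) ∧ alternationTime X α ν k ω < (t : ℕ∞) ∧
        if Even k then
          ν * X t ω ≤ ν * X (alternationTime X α ν k ω).toNat ω - α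
        else
          ν * X t ω ≥ ν * X (alternationTime X α ν k ω).toNat ω + α}

/-- `T'_k = min {T'_{k,1}, T'_{k,-1}}`. -/
noncomputable def firstAlternationTime {Ω : Type*} (X : ℕ → Ω → ℝ) (α : ℝ) (k : ℕ) (ω : Ω) : ℕ∞ :=
  min (alternationTime X α 1 k ω) (alternationTime X α (-1) k ω)

/-- The number `A_t^X(α) = sup {k ≥ 0 | T'_k ≤ t}` of `α`-alternations up to time `t`. -/
noncomputable def alternationsUpTo {Ω : Type*} (X : ℕ → Ω → ℝ) (α : ℝ) (t : ℕ) (ω : Ω) : ℕ∞ :=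
  sSup {n : ℕ∞ | ∃ k : ℕ, n = (k : ℕ∞) ∧ firstAlternationTime X α k ω ≤ (t : ℕ∞)}

/-- The total number `A^X(α) = sup_t A_t^X(α) ∈ ℕ ∪ {∞}` of `α`-alternations. -/
noncomputable def alternations {Ω : Type*} (X : ℕ → Ω → ℝ) (α : ℝ) (ω : Ω) : ℕ∞ :=
  ⨆ t : ℕ, alternationsUpTo X α t ω

/-! Each sign contributes at most `1 / (2 * α)` in expectation. For a decrease first, attach to the
counter state `(n, r)` the potential `n + (1 - x) * slope r` (`n` even) or `n + x * slope (1 - r)`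
(`n` odd). It is affine in `x`, so between updates it moves by a bounded predictable multiple of the
martingale increment, which has mean zero; it does not increase at an alternation
(`alternationPotential_succ_le`), dominates `n`, and starts at most at `1 / (2 * α)`. The other sign
is the same statement for `1 - X`; the maximum of the two counts is at most their sum, and monotone
convergence in `t` finishes. -/

/-- The state `(n, r)` at time `t` of a counter of `α`-alternations along the path `x`, a decrease
coming first: `n` is the number of alternations completed so far, and `r` is the value of `x` when
the last of them was completed (the initial value if there was none). -/
noncomputable def alternationState (x : ℕ → ℝ) (α : ℝ) : ℕ → ℕ × ℝ
  | 0 => (0, x 0)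
  | t + 1 =>
      if (Even (alternationState x α t).1 ∧ x (t + 1) ≤ (alternationState x α t).2 - α) ∨
          (¬ Even (alternationState x α t).1 ∧ (alternationState x α t).2 + α ≤ x (t + 1)) then
        ((alternationState x α t).1 + 1, x (t + 1))
      else alternationState x α t

/-! ### Alternation times and the counter -/

theorem alternationTime_neg_one {Ω : Type*} (X : ℕ → Ω → ℝ) (α : ℝ) (k : ℕ) (ω : Ω) :
    alternationTime X α (-1) k ω = alternationTime (fun t ω => 1 - X t ω) α 1 k ω := by
  induction k with
  | zero => rfl
  | succ k ih =>
    simp only [alternationTime, ih]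
    congr 1
    ext s
    refine exists_congr fun t => and_congr_right fun _ => and_congr_right fun _ => ?_
    split_ifs
    · constructor <;> intro h <;> linarith
    · constructor <;> intro h <;> linarith

theorem alternationTime_le_succ {Ω : Type*} (X : ℕ → Ω → ℝ) (α ν : ℝ) (k : ℕ) (ω : Ω) :
    alternationTime X α ν k ω ≤ alternationTime X α ν (k + 1) ω := by
  rw [alternationTime]
  refine le_sInf ?_
  rintro _ ⟨t, rfl, h, -⟩
  exact h.le

theorem alternationTime_mono {Ω : Type*} (X : ℕ → Ω → ℝ) (α ν : ℝ) (ω : Ω) :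
    Monotone fun k => alternationTime X α ν k ω :=
  monotone_nat_of_le_succ fun k => alternationTime_le_succ X α ν k ω

/-- The `(k + 1)`-st alternation is completed by time `t + 1` only if it is completed by time `t` or
its defining condition holds at time `t + 1`. -/
theorem alternationTime_succ_le_succ_iff {Ω : Type*} (X : ℕ → Ω → ℝ) (α : ℝ) (k t : ℕ) (ω : Ω)
    (h : (t : ℕ∞) < alternationTime X α 1 (k + 1) ω) :
    alternationTime X α 1 (k + 1) ω ≤ (t + 1 : ℕ) ↔
      alternationTime X α 1 k ω < (t + 1 : ℕ) ∧
        ((Even k ∧ X (t + 1) ω ≤ X (alternationTime X α 1 k ω).toNat ω - α) ∨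
          (¬ Even k ∧ X (alternationTime X α 1 k ω).toNat ω + α ≤ X (t + 1) ω)) := by
  constructor
  · intro hle
    rw [alternationTime] at h hle
    -- A strict bound `< t + 2` yields a witness `u` of the infimum; `h` then forces `u = t + 1`.
    obtain ⟨s, ⟨u, rfl, hu, hcond⟩, hs⟩ :=
      sInf_lt_iff.1 (hle.trans_lt (by exact_mod_cast Nat.lt_succ_self (t + 1) :
        ((t + 1 : ℕ) : ℕ∞) < (t + 2 : ℕ)))
    have hlt : (t : ℕ∞) < (u : ℕ∞) := h.trans_le (sInf_le ⟨u, rfl, hu, hcond⟩)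
    have hu' : u = t + 1 := by
      have h1 : t < u := by exact_mod_cast hlt
      have h2 : u < t + 2 := by exact_mod_cast hs
      omega
    subst hu'
    refine ⟨hu, ?_⟩
    split_ifs at hcond with hk
    · exact Or.inl ⟨hk, by linarith⟩
    · exact Or.inr ⟨hk, by linarith⟩
  · rintro ⟨hlt, hcond⟩
    rw [alternationTime]
    refine sInf_le ⟨t + 1, rfl, hlt, ?_⟩
    split_ifs with hk
    · rcases hcond with hc | hc
      · linarith [hc.2]
      · exact absurd hk hc.1
    · rcases hcond with hc | hc
      · exact absurd hc.1 hk
      · linarith [hc.2]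

/-- Excludes two alternations completed at the same time, so a counter advancing by at most one per
step misses none. -/
theorem lt_alternationTime_succ {Ω : Type*} (X : ℕ → Ω → ℝ) (α ν : ℝ) (k t : ℕ) (ω : Ω)
    (h : (t : ℕ∞) ≤ alternationTime X α ν k ω) : (t : ℕ∞) < alternationTime X α ν (k + 1) ω := by
  by_contra! hle
  rw [alternationTime] at hle
  obtain ⟨s, ⟨u, rfl, hu, -⟩, hs⟩ :=
    sInf_lt_iff.1 (hle.trans_lt (by exact_mod_cast Nat.lt_succ_self t : (t : ℕ∞) < (t + 1 : ℕ)))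
  have h1 : t < u := by exact_mod_cast h.trans_lt hu
  have h2 : u < t + 1 := by exact_mod_cast hs
  omega

/-- The counter describes the alternation times of sign `1`. -/
theorem alternationState_spec {Ω : Type*} (X : ℕ → Ω → ℝ) (α : ℝ) (ω : Ω) (t : ℕ) :
    alternationTime X α 1 (alternationState (X · ω) α t).1 ω ≤ t ∧
      X (alternationTime X α 1 (alternationState (X · ω) α t).1 ω).toNat ω =
        (alternationState (X · ω) α t).2 ∧
      t < alternationTime X α 1 ((alternationState (X · ω) α t).1 + 1) ω := by
  induction t with
  | zero =>
    refine ⟨by simp [alternationState, alternationTime],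
      by simp [alternationState, alternationTime], lt_alternationTime_succ _ _ _ _ _ _ (by simp)⟩
  | succ t ih =>
    obtain ⟨h1, h2, h3⟩ := ih
    have hiff := alternationTime_succ_le_succ_iff X α _ t ω h3
    have hlt : alternationTime X α 1 (alternationState (X · ω) α t).1 ω < (t + 1 : ℕ) :=
      h1.trans_lt (by exact_mod_cast Nat.lt_succ_self t)
    rw [h2] at hiff
    rw [alternationState]
    split_ifs with hc
    · have hle := hiff.2 ⟨hlt, hc⟩
      have hge : ((t + 1 : ℕ) : ℕ∞) ≤
          alternationTime X α 1 ((alternationState (X · ω) α t).1 + 1) ω := by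
        rw [Nat.cast_add, Nat.cast_one]
        exact Order.add_one_le_of_lt h3
      refine ⟨hle, ?_, lt_alternationTime_succ _ _ _ _ _ _ hge⟩
      rw [le_antisymm hle hge, ENat.toNat_natCast]
    · exact ⟨hlt.le, h2, lt_of_not_ge fun hle => hc (hiff.1 hle).2⟩

theorem alternationTime_one_le_iff {Ω : Type*} (X : ℕ → Ω → ℝ) (α : ℝ) (ω : Ω) (k t : ℕ) :
    alternationTime X α 1 k ω ≤ t ↔ k ≤ (alternationState (X · ω) α t).1 := by
  obtain ⟨h1, -, h3⟩ := alternationState_spec X α ω t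
  constructor
  · intro h
    by_contra! hlt
    exact absurd (h3.trans_le (alternationTime_mono X α 1 ω hlt)) (not_lt.2 h)
  · intro h
    exact (alternationTime_mono X α 1 ω h).trans h1

theorem alternationsUpTo_eq_max {Ω : Type*} (X : ℕ → Ω → ℝ) (α : ℝ) (t : ℕ) (ω : Ω) :
    alternationsUpTo X α t ω =
      (max (alternationState (X · ω) α t).1 (alternationState (1 - X · ω) α t).1 : ℕ) := by
  have key (k : ℕ) : firstAlternationTime X α k ω ≤ t ↔
      k ≤ max (alternationState (X · ω) α t).1 (alternationState (1 - X · ω) α t).1 := by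
    rw [firstAlternationTime, min_le_iff, alternationTime_neg_one, alternationTime_one_le_iff,
      alternationTime_one_le_iff, le_max_iff]
  refine IsLUB.sSup_eq (IsGreatest.isLUB ⟨⟨_, rfl, (key _).2 le_rfl⟩, ?_⟩)
  rintro _ ⟨k, rfl, hk⟩
  exact_mod_cast (key k).1 hk

theorem alternationsUpTo_mono {Ω : Type*} (X : ℕ → Ω → ℝ) (α : ℝ) (ω : Ω) :
    Monotone fun t => alternationsUpTo X α t ω := by
  intro s t hst
  refine sSup_le_sSup ?_
  rintro _ ⟨k, rfl, hk⟩
  exact ⟨k, rfl, hk.trans (by exact_mod_cast hst)⟩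

/-! ### Adaptedness of the counter -/

theorem measurable_alternationState {Ω : Type*} {m : MeasurableSpace Ω} {ℱ : Filtration ℕ m}
    {X : ℕ → Ω → ℝ} (hX : ∀ t, Measurable[ℱ t] (X t)) (α : ℝ) (t : ℕ) :
    Measurable[ℱ t] fun ω => alternationState (X · ω) α t := by
  induction t with
  | zero =>
    have h0 := hX 0
    simp only [alternationState]
    exact Measurable.prodMk measurable_const h0
  | succ t ih =>
    have hs : Measurable[ℱ (t + 1)] fun ω => alternationState (X · ω) α t :=
      ih.mono (ℱ.mono t.le_succ) le_rfl
    have hx := hX (t + 1)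
    generalize ℱ (t + 1) = m' at hs hx
    have heven : MeasurableSet {ω | Even (alternationState (X · ω) α t).1} :=
      hs.fst (MeasurableSet.of_discrete (s := {n : ℕ | Even n}))
    simp only [alternationState]
    refine Measurable.ite ?_ ((measurable_from_top.comp hs.fst).prodMk hx) hs
    exact (heven.inter (measurableSet_le hx (hs.snd.sub_const α))).union
      (heven.compl.inter (measurableSet_le (hs.snd.add_const α) hx))

/-! ### The potential and the pathwise bound -/

/-- The slope, as a function of the distance of the reference value from the boundary it moves away
from, of the potential that bounds the expected number of further alternations. -/
noncomputable def alternationSlope (α r : ℝ) : ℝ := max 0 ((2 * r - α) / α)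

theorem alternationSlope_nonneg (α r : ℝ) : 0 ≤ alternationSlope α r := le_max_left _ _

theorem alternationSlope_le {α r : ℝ} (hα : 0 < α) (hr : r ≤ 1) :
    alternationSlope α r ≤ 2 / α :=
  max_le (by positivity) (by gcongr; linarith)

/-- The constant comes from `2 * r * (1 - r) ≤ 1 / 2`. -/
theorem one_sub_mul_alternationSlope_le {α r : ℝ} (hα : 0 < α) (hr1 : r ≤ 1) :
    (1 - r) * alternationSlope α r ≤ 1 / (2 * α) := by
  rw [alternationSlope, mul_max_of_nonneg _ _ (sub_nonneg.2 hr1)]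
  refine max_le (by simp; positivity) ?_
  rw [← mul_div_assoc, div_le_div_iff₀ hα (by positivity)]
  nlinarith [mul_nonneg hα.le (mul_nonneg hα.le (sub_nonneg.2 hr1)),
    mul_nonneg hα.le (sq_nonneg (2 * r - 1))]

/-- The potential does not increase when an alternation from `y` down to `z` is counted. -/
theorem one_add_mul_alternationSlope_le {α y z : ℝ} (hα : 0 < α) (hz : 0 ≤ z) (hy : y ≤ 1)
    (hzy : z ≤ y - α) :
    1 + z * alternationSlope α (1 - z) ≤ (1 - z) * alternationSlope α y := by
  -- Since `z ≤ y - α ≤ 1 - α`, the truncation at `0` is inactive here.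
  have h1 : alternationSlope α (1 - z) ≤ (2 * (1 - z) - α) / α :=
    max_le (div_nonneg (by linarith) hα.le) le_rfl
  have h2 : (2 * z + α) / α ≤ alternationSlope α y :=
    le_max_of_le_right (by gcongr; linarith)
  calc 1 + z * alternationSlope α (1 - z) ≤ 1 + z * ((2 * (1 - z) - α) / α) := by gcongr
    -- The slope is chosen to give equality for a fall of exactly `α`.
    _ = (1 - z) * ((2 * z + α) / α) := by field_simp; ring
    _ ≤ (1 - z) * alternationSlope α y := by gcongr; linarith

/-- The number of units of the martingale held, in state `(n, r)`, to hedge the alternations. -/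
noncomputable def alternationHedge (α : ℝ) (s : ℕ × ℝ) : ℝ :=
  if Even s.1 then -alternationSlope α s.2 else alternationSlope α (1 - s.2)

/-- The potential in state `(n, r)` at the value `x`: the number of alternations so far, and an upper
bound for the expected number of further ones. -/
noncomputable def alternationPotential (α : ℝ) (s : ℕ × ℝ) (x : ℝ) : ℝ :=
  s.1 + if Even s.1 then (1 - x) * alternationSlope α s.2 else x * alternationSlope α (1 - s.2)

theorem measurable_alternationHedge (α : ℝ) : Measurable (alternationHedge α) := by
  have h : Measurable (alternationSlope α) := by unfold alternationSlope; fun_prop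
  refine Measurable.ite ?_ (h.comp measurable_snd).neg (h.comp (measurable_snd.const_sub 1))
  exact measurable_fst (MeasurableSet.of_discrete (s := {n : ℕ | Even n}))

theorem abs_alternationHedge_le {α : ℝ} (hα : 0 < α) {s : ℕ × ℝ} (h0 : 0 ≤ s.2) (h1 : s.2 ≤ 1) :
    |alternationHedge α s| ≤ 2 / α := by
  rw [alternationHedge]
  split_ifs
  · rw [abs_neg, abs_of_nonneg (alternationSlope_nonneg _ _)]
    exact alternationSlope_le hα h1
  · rw [abs_of_nonneg (alternationSlope_nonneg _ _)]
    exact alternationSlope_le hα (by linarith)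

theorem le_alternationPotential (α : ℝ) (s : ℕ × ℝ) {x : ℝ} (h0 : 0 ≤ x) (h1 : x ≤ 1) :
    (s.1 : ℝ) ≤ alternationPotential α s x := by
  rw [alternationPotential, le_add_iff_nonneg_right]
  split_ifs
  · exact mul_nonneg (by linarith) (alternationSlope_nonneg _ _)
  · exact mul_nonneg h0 (alternationSlope_nonneg _ _)

theorem alternationPotential_eq (α : ℝ) (s : ℕ × ℝ) (x y : ℝ) :
    alternationPotential α s y = alternationPotential α s x + alternationHedge α s * (y - x) := by
  simp only [alternationPotential, alternationHedge]
  split_ifs <;> ring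

theorem alternationState_snd_mem {x : ℕ → ℝ} (hx : ∀ t, 0 ≤ x t ∧ x t ≤ 1) (α : ℝ) (t : ℕ) :
    0 ≤ (alternationState x α t).2 ∧ (alternationState x α t).2 ≤ 1 := by
  induction t with
  | zero => exact hx 0
  | succ t ih =>
    rw [alternationState]
    split_ifs
    · exact hx (t + 1)
    · exact ih

theorem alternationPotential_succ_le {x : ℕ → ℝ} (hx : ∀ t, 0 ≤ x t ∧ x t ≤ 1) {α : ℝ} (hα : 0 < α)
    (t : ℕ) :
    alternationPotential α (alternationState x α (t + 1)) (x (t + 1)) ≤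
      alternationPotential α (alternationState x α t) (x (t + 1)) := by
  obtain ⟨hr0, hr1⟩ := alternationState_snd_mem hx α t
  obtain ⟨hx0, hx1⟩ := hx (t + 1)
  rw [alternationState]
  split_ifs with hc
  · simp only [alternationPotential, Nat.even_add_one]
    rcases hc with ⟨he, hle⟩ | ⟨he, hle⟩
    · simp only [he, not_true_eq_false, if_true, if_false, Nat.cast_add, Nat.cast_one]
      linarith [one_add_mul_alternationSlope_le hα hx0 hr1 hle]
    · simp only [he, not_false_eq_true, if_true, if_false, Nat.cast_add, Nat.cast_one]
      -- A rise of `x` is a fall of `1 - x`.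
      have := one_add_mul_alternationSlope_le (y := 1 - (alternationState x α t).2)
        (z := 1 - x (t + 1)) hα (by linarith) (by linarith) (by linarith)
      rw [sub_sub_cancel] at this
      linarith
  · exact le_rfl

/-- The number of alternations of a path in `[0, 1]` is at most `1 / (2 * α)` plus the gain of a
trading strategy. -/
theorem alternationState_fst_le {x : ℕ → ℝ} (hx : ∀ t, 0 ≤ x t ∧ x t ≤ 1) {α : ℝ} (hα : 0 < α)
    (t : ℕ) :
    ((alternationState x α t).1 : ℝ) ≤ 1 / (2 * α) +
      ∑ s ∈ Finset.range t, alternationHedge α (alternationState x α s) * (x (s + 1) - x s) := by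
  refine (le_alternationPotential α _ (hx t).1 (hx t).2).trans ?_
  induction t with
  | zero =>
    simpa [alternationState, alternationPotential] using
      one_sub_mul_alternationSlope_le hα (hx 0).2
  | succ t ih =>
    have h1 := alternationPotential_succ_le hx hα t
    have h2 := alternationPotential_eq α (alternationState x α t) (x t) (x (t + 1))
    rw [Finset.sum_range_succ]
    linarith

/-! ### Expectations -/

theorem integrable_mul_sub_and_integral_eq_zero {Ω : Type*} {m : MeasurableSpace Ω} {P : Measure Ω}
    [IsFiniteMeasure P] {ℱ : Filtration ℕ m} {X : ℕ → Ω → ℝ} (hX : Martingale X ℱ P) (t : ℕ)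
    {H : Ω → ℝ} (hH : StronglyMeasurable[ℱ t] H) {C : ℝ} (hC : ∀ᵐ ω ∂P, ‖H ω‖ ≤ C) :
    Integrable (fun ω => H ω * (X (t + 1) ω - X t ω)) P ∧
      ∫ ω, H ω * (X (t + 1) ω - X t ω) ∂P = 0 := by
  have hHm : AEStronglyMeasurable H P := (hH.mono (ℱ.le t)).aestronglyMeasurable
  have h1 : Integrable (fun ω => H ω * X (t + 1) ω) P := (hX.integrable (t + 1)).bdd_mul hHm hC
  have h0 : Integrable (fun ω => H ω * X t ω) P := (hX.integrable t).bdd_mul hHm hC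
  have heq : ∫ ω, H ω * X (t + 1) ω ∂P = ∫ ω, H ω * X t ω ∂P := by
    rw [← integral_condExp (ℱ.le t)]
    refine integral_congr_ae ?_
    filter_upwards [condExp_mul_of_stronglyMeasurable_left hH h1 (hX.integrable (t + 1)),
      hX.condExp_ae_eq t.le_succ] with ω hω hω'
    exact hω.trans (congrArg (H ω * ·) hω')
  simp only [mul_sub]
  exact ⟨h1.sub h0, by rw [integral_sub h1 h0, heq, sub_self]⟩

theorem lintegral_alternationState_fst_le {Ω : Type*} {m : MeasurableSpace Ω} {P : Measure Ω}
    [IsProbabilityMeasure P] {ℱ : Filtration ℕ m} {X : ℕ → Ω → ℝ} (hX : Martingale X ℱ P)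
    (hX01 : ∀ t : ℕ, ∀ᵐ ω ∂P, 0 ≤ X t ω ∧ X t ω ≤ 1) {α : ℝ} (hα : 0 < α) (t : ℕ) :
    ∫⁻ ω, ((alternationState (X · ω) α t).1 : ℝ≥0∞) ∂P ≤ ENNReal.ofReal (1 / (2 * α)) := by
  have hae : ∀ᵐ ω ∂P, ∀ t, 0 ≤ X t ω ∧ X t ω ≤ 1 := ae_all_iff.2 hX01
  have hstep (s : ℕ) := integrable_mul_sub_and_integral_eq_zero hX s
    (H := fun ω => alternationHedge α (alternationState (X · ω) α s)) (C := 2 / α)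
    ((measurable_alternationHedge α).comp
      (measurable_alternationState (fun t => (hX.stronglyMeasurable t).measurable) α s)
      |>.stronglyMeasurable)
    (by
      filter_upwards [hae] with ω hω
      obtain ⟨h0, h1⟩ := alternationState_snd_mem hω α s
      exact abs_alternationHedge_le hα h0 h1)
  have hsum := integrable_finsetSum (Finset.range t) fun s _ => (hstep s).1
  have hle : ∀ᵐ ω ∂P, ((alternationState (X · ω) α t).1 : ℝ) ≤ 1 / (2 * α) +
      ∑ s ∈ Finset.range t, alternationHedge α (alternationState (X · ω) α s) *
        (X (s + 1) ω - X s ω) := by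
    filter_upwards [hae] with ω hω
    exact alternationState_fst_le hω hα t
  have hint : ∫ ω, (1 / (2 * α) + ∑ s ∈ Finset.range t,
      alternationHedge α (alternationState (X · ω) α s) * (X (s + 1) ω - X s ω)) ∂P =
        1 / (2 * α) := by
    rw [integral_add (integrable_const _) hsum, integral_finsetSum _ fun s _ => (hstep s).1,
      Finset.sum_eq_zero fun s _ => (hstep s).2]
    simp
  calc ∫⁻ ω, ((alternationState (X · ω) α t).1 : ℝ≥0∞) ∂P
      ≤ ∫⁻ ω, ENNReal.ofReal (1 / (2 * α) + ∑ s ∈ Finset.range t,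
          alternationHedge α (alternationState (X · ω) α s) * (X (s + 1) ω - X s ω)) ∂P := by
        refine lintegral_mono_ae ?_
        filter_upwards [hle] with ω hω
        rw [← ENNReal.ofReal_natCast]
        exact ENNReal.ofReal_le_ofReal hω
    _ = ENNReal.ofReal (1 / (2 * α)) := by
        refine ((ofReal_integral_eq_lintegral_ofReal ((integrable_const _).add hsum) ?_).symm.trans
          (congrArg ENNReal.ofReal hint))
        -- The integrand is nonnegative because it dominates a count.
        filter_upwards [hle] with ω hω
        exact (Nat.cast_nonneg _).trans hω

theorem measurable_alternationsUpTo {Ω : Type*} {m : MeasurableSpace Ω} {ℱ : Filtration ℕ m}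
    {X : ℕ → Ω → ℝ} (hX : ∀ t, Measurable[ℱ t] (X t)) (α : ℝ) (t : ℕ) :
    Measurable (alternationsUpTo X α t) := by
  have h1 := (measurable_alternationState hX α t).mono (ℱ.le t) le_rfl
  have h2 := (measurable_alternationState (fun t => (hX t).const_sub 1) α t).mono (ℱ.le t) le_rfl
  simp only [funext (alternationsUpTo_eq_max X α t)]
  exact (measurable_of_countable fun p : ℕ × ℕ => ((max p.1 p.2 : ℕ) : ℕ∞)).comp
    (h1.fst.prodMk h2.fst)

/-- For a martingale with values in `[0, 1]`, the total number `A(α)` of `α`-alternations is a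
random variable with values in `ℕ ∪ {∞}`, and its expectation is at most `1 / α`. -/
theorem mainTheorem8 {Ω : Type*} {m : MeasurableSpace Ω} (P : Measure Ω) [IsProbabilityMeasure P]
    (ℱ : Filtration ℕ m) (X : ℕ → Ω → ℝ) (hX : Martingale X ℱ P)
    (hX01 : ∀ t : ℕ, ∀ᵐ ω ∂P, 0 ≤ X t ω ∧ X t ω ≤ 1) (α : ℝ) (hα : 0 < α) :
    Measurable (alternations X α) ∧
      ∫⁻ ω, (alternations X α ω : ℝ≥0∞) ∂P ≤ ENNReal.ofReal (1 / α) := by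
  have hXm (t : ℕ) : Measurable[ℱ t] (X t) := (hX.stronglyMeasurable t).measurable
  have hmeas := measurable_alternationsUpTo hXm α
  have : BorelSpace ℕ∞ := ⟨borel_eq_top_of_countable.symm⟩
  refine ⟨Measurable.iSup hmeas, ?_⟩
  have hY : Martingale (fun t ω => 1 - X t ω) ℱ P := (martingale_const ℱ P (1 : ℝ)).sub hX
  have hY01 (t : ℕ) : ∀ᵐ ω ∂P, 0 ≤ 1 - X t ω ∧ 1 - X t ω ≤ 1 := by
    filter_upwards [hX01 t] with ω hω
    exact ⟨by linarith [hω.2], by linarith [hω.1]⟩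
  simp only [alternations, ENat.toENNReal_iSup]
  -- Monotone convergence reduces the bound to a fixed `t`.
  rw [lintegral_iSup (f := fun t ω => (alternationsUpTo X α t ω : ℝ≥0∞))
    (fun t => (measurable_of_countable ENat.toENNReal).comp (hmeas t))
    fun s t hst ω => ENat.toENNReal_mono (alternationsUpTo_mono X α ω hst)]
  refine iSup_le fun t => ?_
  have hN := (measurable_alternationState hXm α t).mono (ℱ.le t) le_rfl |>.fst
  calc ∫⁻ ω, (alternationsUpTo X α t ω : ℝ≥0∞) ∂P
      ≤ ∫⁻ ω, (((alternationState (X · ω) α t).1 : ℝ≥0∞) +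
          ((alternationState (1 - X · ω) α t).1 : ℝ≥0∞)) ∂P := by
        -- Bounding the maximum by the sum turns the two bounds `1 / (2 * α)` into `1 / α`.
        refine lintegral_mono fun ω => ?_
        rw [alternationsUpTo_eq_max, ENat.toENNReal_coe, ← Nat.cast_add]
        exact Nat.cast_le.2 (max_le (Nat.le_add_right _ _) (Nat.le_add_left _ _))
    _ = ∫⁻ ω, ((alternationState (X · ω) α t).1 : ℝ≥0∞) ∂P +
          ∫⁻ ω, ((alternationState (1 - X · ω) α t).1 : ℝ≥0∞) ∂P :=
        lintegral_add_left (measurable_from_top.comp hN) _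
    _ ≤ ENNReal.ofReal (1 / (2 * α)) + ENNReal.ofReal (1 / (2 * α)) :=
        add_le_add (lintegral_alternationState_fst_le hX hX01 hα t)
          (lintegral_alternationState_fst_le hY hY01 hα t)
    _ = ENNReal.ofReal (1 / α) := by
        rw [← ENNReal.ofReal_add (by positivity) (by positivity)]
        congr 1
        field_simp
        norm_num
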